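/- A Cu-semigroup is a positively ordered commutative monoid $S$ (a commutative monoid with a partial order that is compatible with addition and satisfies $0\le x$ for all $x$) such that: (O1) every increasing sequence in $S$ has a supremum; (O2) every element is the supremum of a sequence $(x_n)_n$ with $x_n\ll x_{n+1}$ for all $n$; (O3) if $x'\ll x$ and $y'\ll y$, then $x'+y'\ll x+y$; (O4) $\sup_n(x_n+y_n)=\sup_n x_n+\sup_n y_n$ for all increasing sequences $(x_n)_n,(y_n)_n$. Here $x\ll y$ means that for every increasing sequence $(z_n)_n$ with $y\le\sup_n z_n$ there is $n$ with $x\le z_n$. Write $\infty x=\sup_n nx$. Consider the following properties, in which all elements lie in $S$: (O5) if $x'\ll x$, $y'\ll y$ and $x+y\le z$, then there is $c$ with $x'+c\le z\le x+c$ and $y'\ll c$; (O6) if $x'\ll x\le y+z$, then there are $e\le x,y$ and $f\le x,z$ with $x'\le e+f$; (O7) if $x'\ll x\le z$ and $y'\ll y\le z$, then there is $w$ with $x',y'\ll w\le z,\,x+y$; (O8) if $x'\ll x$, $y'\ll y$, $2w=w$ and $x+y\ll z+w$, then there are $z_1,z_2$ with $z_1+z_2\ll z$, $x'\ll z_1+w$,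 $z_1\ll x+w$, $y'\ll z_2+w$ and $z_2\ll y+w$. An ideal of $S$ is a downward-hereditary submonoid closed under suprema of increasing sequences. A scale of $S$ is a downward-hereditary subset $\Sigma\subseteq S$ that is closed under suprema of increasing sequences and generates $S$ as an ideal. An element $x\in S$ is - $(2,\omega)$-divisible if for every $x'\ll x$ there are $y\in S$ and $n\in\mathbb N$ with $2y\le x$ and $x'\le ny$; - weakly $(2,\omega)$-divisible if for every $x'\ll x$ there are finitely many $y_1,\dots,y_n\in S$ with $2y_j\le x$ for all $j$ and $x'\le y_1+\dots+y_n$; - strongly soft if for every $x'\ll x$ there is $t\in S$ with $x'+t\ll x$ and $x'\ll\infty t$. The semigroup $S$ is $(2,\omega)$-divisible if all its elements are. The pair $(S,\Sigma)$ - is ideal-filtered if for all $v',v\in S$ and $x,y\in\Sigma$ with $v'\ll v\ll\infty x,\infty y$ there is $z\in S$ with $v'\ll\infty z$ and $z\ll x,y$; - has property (V) if for all $d_1',d_1,d_2',d_2,c,x\in\Sigma$ with $d_1'\ll d_1$, $d_2'\ll d_2$, $d_1,d_2\ll c$ and $c+d_1,c+d_2\ll x$ there are $y,z\in S$ with $y+z\le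 x$ and $d_1'+d_2'\le\infty y,\infty z$; - has an abundance of strongly soft elements if for all $x',x\in\Sigma$ with $x'\ll x$ there is a strongly soft $y\in S$ with $x'\le\infty y$ and $y\le x$. Theorem. Let $S$ be a Cu-semigroup satisfying (O5)-(O8), and let $\Sigma\subseteq S$ be a scale. Then the following are equivalent: 1. $S$ is $(2,\omega)$-divisible. 2. Every element of $\Sigma$ is $(2,\omega)$-divisible. 3. Every element of $\Sigma$ is weakly $(2,\omega)$-divisible, and $(S,\Sigma)$ is ideal-filtered and has property (V). 4. $(S,\Sigma)$ is ideal-filtered, and for every $x\in S$ there is a strongly soft element $y\in S$ with $2y\le x\le\infty y$. 5. $(S,\Sigma)$ is ideal-filtered and has an abundance of strongly soft elements. -/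

import Mathlib

namespace Cu

/-- The sequential way-below relation: whenever `y ≤ sup_n z n` for an increasing sequence `z`
that has a supremum, `x ≤ z n` for some `n`. -/
def WayBelow {S : Type*} [Preorder S] (x y : S) : Prop :=
  ∀ (z : ℕ → S) (s : S), Monotone z → IsLUB (Set.range z) s → y ≤ s → ∃ n, x ≤ z n

infix:50 " ≪ " => WayBelow

/-- A Cu-semigroup: a positively ordered commutative monoid (the order is compatible with
addition and `0` is the least element) that satisfies the axioms (O1)-(O4). -/
class CuSemigroup (S : Type*) [AddCommMonoid S] [PartialOrder S] : Prop
    extends IsOrderedAddMonoid S where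
  zero_le' : ∀ x : S, 0 ≤ x
  /-- (O1) -/
  exists_isLUB : ∀ z : ℕ → S, Monotone z → ∃ s, IsLUB (Set.range z) s
  /-- (O2) -/
  exists_wayBelow_seq : ∀ x : S, ∃ z : ℕ → S,
    (∀ n, z n ≪ z (n + 1)) ∧ IsLUB (Set.range z) x
  /-- (O3) -/
  add_wayBelow_add : ∀ x' x y' y : S, x' ≪ x → y' ≪ y → x' + y' ≪ x + y
  /-- (O4) -/
  isLUB_add : ∀ (x y : ℕ → S) (a b : S), Monotone x → Monotone y →
    IsLUB (Set.range x) a → IsLUB (Set.range y) b →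
    IsLUB (Set.range fun n => x n + y n) (a + b)

section Axioms

variable (S : Type*) [AddCommMonoid S] [PartialOrder S]

/-- (O5) -/
def O5 : Prop :=
  ∀ x' x y' y z : S, x' ≪ x → y' ≪ y → x + y ≤ z →
    ∃ c : S, x' + c ≤ z ∧ z ≤ x + c ∧ y' ≪ c

/-- (O6) -/
def O6 : Prop :=
  ∀ x' x y z : S, x' ≪ x → x ≤ y + z →
    ∃ e f : S, e ≤ x ∧ e ≤ y ∧ f ≤ x ∧ f ≤ z ∧ x' ≤ e + f

/-- (O7) -/
def O7 : Prop :=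
  ∀ x' x y' y z : S, x' ≪ x → x ≤ z → y' ≪ y → y ≤ z →
    ∃ w : S, x' ≪ w ∧ y' ≪ w ∧ w ≤ z ∧ w ≤ x + y

/-- (O8) -/
def O8 : Prop :=
  ∀ x' x y' y z w : S, 2 • w = w → x' ≪ x → y' ≪ y → x + y ≪ z + w →
    ∃ z₁ z₂ : S, z₁ + z₂ ≪ z ∧
      x' ≪ z₁ + w ∧ z₁ ≪ x + w ∧ y' ≪ z₂ + w ∧ z₂ ≪ y + w

end Axioms

section Elements

variable {S : Type*} [AddCommMonoid S] [PartialOrder S]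

theorem monotone_nsmul [CuSemigroup S] (x : S) : Monotone fun n : ℕ => n • x :=
  fun _ _ h => nsmul_le_nsmul_left (CuSemigroup.zero_le' x) h

/-- The element `∞x`, the supremum of the increasing sequence `n ↦ n • x`. -/
noncomputable def infty [CuSemigroup S] (x : S) : S :=
  Classical.choose (CuSemigroup.exists_isLUB (fun n : ℕ => n • x) (monotone_nsmul x))

theorem isLUB_infty [CuSemigroup S] (x : S) :
    IsLUB (Set.range fun n : ℕ => n • x) (infty x) :=
  Classical.choose_spec (CuSemigroup.exists_isLUB (fun n : ℕ => n • x) (monotone_nsmul x))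

/-- `x ⊲ y`: the element `x` lies in the ideal generated by `y`, that is, `x ≤ ∞y`. -/
def IdealLE [CuSemigroup S] (x y : S) : Prop := x ≤ infty y

def IsStronglySoft [CuSemigroup S] (x : S) : Prop :=
  ∀ x' : S, x' ≪ x → ∃ t : S, x' + t ≪ x ∧ x' ≪ infty t

/-- The element `x` is `(2,ω)`-divisible. -/
def IsTwoOmegaDivisible (x : S) : Prop :=
  ∀ x' : S, x' ≪ x → ∃ (y : S) (n : ℕ), 2 • y ≤ x ∧ x' ≤ n • y

/-- The element `x` is weakly `(2,ω)`-divisible. -/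
def IsWeaklyTwoOmegaDivisible (x : S) : Prop :=
  ∀ x' : S, x' ≪ x → ∃ (n : ℕ) (y : Fin n → S), (∀ j, 2 • y j ≤ x) ∧ x' ≤ ∑ j, y j

/-- Closed under suprema of increasing sequences. -/
def IsSeqSupClosed (T : Set S) : Prop :=
  ∀ (z : ℕ → S) (s : S), Monotone z → (∀ n, z n ∈ T) → IsLUB (Set.range z) s → s ∈ T

/-- An ideal: a downward-hereditary submonoid that is closed under suprema of increasing
sequences. -/
structure IsIdeal (I : Set S) : Prop where
  zero_mem : 0 ∈ I
  add_mem : ∀ x ∈ I, ∀ y ∈ I, x + y ∈ I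
  isLowerSet : IsLowerSet I
  isSeqSupClosed : IsSeqSupClosed I

/-- A scale: a downward-hereditary subset that is closed under suprema of increasing sequences
and that generates the whole semigroup as an ideal. -/
structure IsScale (T : Set S) : Prop where
  isSeqSupClosed : IsSeqSupClosed T
  isLowerSet : IsLowerSet T
  generates : ∀ I : Set S, IsIdeal I → T ⊆ I → I = Set.univ

end Elements

/-- The semigroup `S` is `(2,ω)`-divisible. -/
def TwoOmegaDivisible (S : Type*) [AddCommMonoid S] [PartialOrder S] : Prop :=
  ∀ x : S, IsTwoOmegaDivisible x

section Scaled

variable {S : Type*} [AddCommMonoid S] [PartialOrder S]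

/-- The pair `(S, T)` is ideal-filtered. -/
def IsIdealFiltered [CuSemigroup S] (T : Set S) : Prop :=
  ∀ v' v : S, ∀ x ∈ T, ∀ y ∈ T, v' ≪ v → v ≪ infty x → v ≪ infty y →
    ∃ z : S, v' ≪ infty z ∧ z ≪ x ∧ z ≪ y

/-- The pair `(S, T)` has property (V). -/
def HasPropertyV [CuSemigroup S] (T : Set S) : Prop :=
  ∀ d₁' ∈ T, ∀ d₁ ∈ T, ∀ d₂' ∈ T, ∀ d₂ ∈ T, ∀ c ∈ T, ∀ x ∈ T,
    d₁' ≪ d₁ → d₂' ≪ d₂ → d₁ ≪ c → d₂ ≪ c → c + d₁ ≪ x → c + d₂ ≪ x →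
    ∃ y z : S, y + z ≤ x ∧ d₁' + d₂' ≤ infty y ∧ d₁' + d₂' ≤ infty z

/-- The pair `(S, T)` has an abundance of strongly soft elements. -/
def HasAbundanceOfStronglySoft [CuSemigroup S] (T : Set S) : Prop :=
  ∀ x' ∈ T, ∀ x ∈ T, x' ≪ x → ∃ y : S, IsStronglySoft y ∧ IdealLE x' y ∧ y ≤ x

end Scaled

end Cu

namespace Cu

/-! ### Monotonicity of the way-below relation. -/

section Order

variable {S : Type*} [PartialOrder S]

/-! Divisibility of `x` only has to be tested up to ideals: each `x' ≪ x` must lie in the ideal of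
some `y` with `2 • y ≤ x`. Given several such elements, the task is to merge them into one. The
recurring device is (O5): if `2 • h ≤ x`, then next to a slightly smaller `h'` there remains a
complement that generates the same ideal as `x`.

For a scale, `x'` lies below a finite sum of divisible elements; (O6) cuts it into pieces, and (O6),
(O7) fit each new piece into the complement (`IsScale.twoOmegaDivisible`). Fitting elements next to
each other also yields ideal-filteredness. Conversely, property (V) and ideal-filteredness merge two
halves (`exists_two_nsmul_le_of_propertyV`).

A strongly soft `y` contains `y' + t` with `y'` in the ideal of `t`, so a common part of `y'` and
`t` fits twice. Conversely, repeated halving builds a strongly soft element as a series, each term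
of which dominates the preceding partial sum (`exists_isStronglySoft`). -/

theorem WayBelow.mono {x' x y y' : S} (hx : x' ≤ x) (h : x ≪ y) (hy : y ≤ y') : x' ≪ y' :=
  fun z s hz hs hys => (h z s hz hs (hy.trans hys)).imp fun _ hn => hx.trans hn

theorem WayBelow.trans_le {x y y' : S} (h : x ≪ y) (hy : y ≤ y') : x ≪ y' :=
  h.mono le_rfl hy

theorem WayBelow.le {x y : S} (h : x ≪ y) : x ≤ y := by
  obtain ⟨_, hn⟩ := h (fun _ => y) y monotone_const (by simp) le_rfl
  exact hn

theorem _root_.LE.le.trans_wayBelow {x' x y : S} (hx : x' ≤ x) (h : x ≪ y) : x' ≪ y :=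
  h.mono hx le_rfl

theorem WayBelow.trans {x y z : S} (h : x ≪ y) (h' : y ≪ z) : x ≪ z :=
  h.trans_le h'.le

end Order

theorem IsTwoOmegaDivisible.isWeaklyTwoOmegaDivisible {S : Type*} [AddCommMonoid S]
    [PartialOrder S] {x : S} (hx : IsTwoOmegaDivisible x) : IsWeaklyTwoOmegaDivisible x := by
  intro x' hx'
  obtain ⟨y, n, hy, hn⟩ := hx x' hx'
  exact ⟨n, fun _ => y, fun _ => hy, by simpa using hn⟩

/-! ### Interpolation, the ideals `∞x`, and complements. -/

section Basic

variable {S : Type*} [AddCommMonoid S] [PartialOrder S] [CuSemigroup S]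

theorem zero_le (x : S) : 0 ≤ x := CuSemigroup.zero_le' x

theorem le_add_left' (x y : S) : x ≤ y + x := le_add_of_nonneg_left (zero_le y)

theorem le_add_right' (x y : S) : x ≤ x + y := le_add_of_nonneg_right (zero_le y)

theorem zero_wayBelow (x : S) : 0 ≪ x := fun z _ _ _ _ => ⟨0, zero_le (z 0)⟩

theorem exists_seq (x : S) :
    ∃ z : ℕ → S, Monotone z ∧ (∀ n, z n ≪ x) ∧ IsLUB (Set.range z) x := by
  obtain ⟨z, hz, hs⟩ := CuSemigroup.exists_wayBelow_seq x
  exact ⟨z, monotone_nat_of_le_succ fun n => (hz n).le,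
    fun n => (hz n).trans_le (hs.1 ⟨n + 1, rfl⟩), hs⟩

theorem WayBelow.exists_between {x y : S} (h : x ≪ y) : ∃ z, x ≪ z ∧ z ≪ y := by
  obtain ⟨z, hz, hs⟩ := CuSemigroup.exists_wayBelow_seq y
  obtain ⟨n, hn⟩ := h z y (monotone_nat_of_le_succ fun n => (hz n).le) hs le_rfl
  exact ⟨z (n + 1), hn.trans_wayBelow (hz n), (hz (n + 1)).trans_le (hs.1 ⟨n + 2, rfl⟩)⟩

theorem WayBelow.exists_wayBelow {x s : S} (h : x ≪ s) {z : ℕ → S} (hz : Monotone z)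
    (hs : IsLUB (Set.range z) s) : ∃ n, x ≪ z n := by
  obtain ⟨y, hxy, hys⟩ := h.exists_between
  exact (hys z s hz hs le_rfl).imp fun n hn => hxy.trans_le hn

theorem WayBelow.exists_upper {x y z : S} (hx : x ≪ z) (hy : y ≪ z) :
    ∃ w, x ≪ w ∧ y ≪ w ∧ w ≪ z := by
  obtain ⟨s, hmono, hsz, hs⟩ := exists_seq z
  obtain ⟨m, hm⟩ := hx.exists_wayBelow hmono hs
  obtain ⟨n, hn⟩ := hy.exists_wayBelow hmono hs
  exact ⟨s (max m n), hm.trans_le (hmono (le_max_left ..)), hn.trans_le (hmono (le_max_right ..)),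
    hsz _⟩

theorem WayBelow.add {x' x y' y : S} (hx : x' ≪ x) (hy : y' ≪ y) : x' + y' ≪ x + y :=
  CuSemigroup.add_wayBelow_add _ _ _ _ hx hy

theorem WayBelow.exists_add {x a b : S} (h : x ≪ a + b) :
    ∃ a' b', a' ≪ a ∧ b' ≪ b ∧ x ≪ a' + b' := by
  obtain ⟨s, hs, hsa, hsl⟩ := exists_seq a
  obtain ⟨t, ht, htb, htl⟩ := exists_seq b
  obtain ⟨n, hn⟩ := h.exists_wayBelow (hs.add ht) (CuSemigroup.isLUB_add s t a b hs ht hsl htl)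
  exact ⟨s n, t n, hsa n, htb n, hn⟩

theorem isLUB_nsmul {z : ℕ → S} {s : S} (hz : Monotone z) (hs : IsLUB (Set.range z) s) (n : ℕ) :
    IsLUB (Set.range fun k => n • z k) (n • s) := by
  induction n with
  | zero => simp
  | succ n ih =>
    simp only [succ_nsmul]
    exact CuSemigroup.isLUB_add _ z _ s (fun i j hij => nsmul_le_nsmul_right (hz hij) n) hz ih hs

theorem WayBelow.exists_nsmul {x y : S} {n : ℕ} (h : x ≪ n • y) : ∃ y', y' ≪ y ∧ x ≪ n • y' := by
  obtain ⟨s, hs, hsy, hsl⟩ := exists_seq y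
  obtain ⟨k, hk⟩ := h.exists_wayBelow (fun i j hij => nsmul_le_nsmul_right (hs hij) n)
    (isLUB_nsmul hs hsl n)
  exact ⟨s k, hsy k, hk⟩

theorem WayBelow.two_nsmul {x y : S} (h : x ≪ y) : 2 • x ≪ 2 • y := by
  simpa only [_root_.two_nsmul] using h.add h

theorem nsmul_le_infty (n : ℕ) (x : S) : n • x ≤ infty x := (isLUB_infty x).1 ⟨n, rfl⟩

theorem le_infty (x : S) : x ≤ infty x := by simpa using nsmul_le_infty 1 x

theorem infty_add_infty (x : S) : infty x + infty x = infty x := by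
  have h := CuSemigroup.isLUB_add _ _ _ _ (monotone_nsmul x) (monotone_nsmul x)
    (isLUB_infty x) (isLUB_infty x)
  refine le_antisymm (h.2 ?_) (le_add_right' _ _)
  rintro _ ⟨n, rfl⟩
  simpa only [← add_nsmul] using nsmul_le_infty (n + n) x

theorem add_le_infty {x y z : S} (hx : x ≤ infty z) (hy : y ≤ infty z) : x + y ≤ infty z :=
  (add_le_add hx hy).trans (infty_add_infty z).le

theorem nsmul_le_infty_of_le {x y : S} (h : x ≤ infty y) (n : ℕ) : n • x ≤ infty y := by
  induction n with
  | zero => simpa using zero_le _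
  | succ n ih => simpa only [succ_nsmul] using add_le_infty ih h

theorem infty_le_infty_of_le {x y : S} (h : x ≤ infty y) : infty x ≤ infty y := by
  refine (isLUB_infty x).2 ?_
  rintro _ ⟨n, rfl⟩
  exact nsmul_le_infty_of_le h n

theorem infty_mono {x y : S} (h : x ≤ y) : infty x ≤ infty y :=
  infty_le_infty_of_le (h.trans (le_infty y))

theorem WayBelow.exists_le_nsmul {x y : S} (h : x ≪ infty y) : ∃ n : ℕ, x ≪ n • y :=
  h.exists_wayBelow (monotone_nsmul y) (isLUB_infty y)

theorem WayBelow.exists_infty {x y : S} (h : x ≪ infty y) : ∃ y', y' ≪ y ∧ x ≪ infty y' := by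
  obtain ⟨n, hn⟩ := h.exists_le_nsmul
  obtain ⟨y', hy', hx⟩ := hn.exists_nsmul
  exact ⟨y', hy', hx.trans_le (nsmul_le_infty n y')⟩

/-- To show that an element way below a finite sum of elements of `A` has a property, it suffices
to treat the parts it has in common with each of the summands. -/
theorem wayBelow_sum_induction (h6 : O6 S) {A : Set S} {D : S → Prop} {a : S} (zero : D 0)
    (mono : ∀ b' b, b' ≤ b → D b → D b')
    (step : ∀ e' e t b' b, e' ≪ e → e ≤ a → t ∈ A → e ≤ t → b' ≪ b → D b → D (e' + b'))
    {s : S} (hs : s ∈ AddSubmonoid.closure A) :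
    ∀ x' x, x' ≪ x → x ≤ a → x ≤ s → D x' := by
  induction hs using AddSubmonoid.closure_induction_left with
  | zero => exact fun x' x hx _ h => mono _ _ (hx.le.trans h) zero
  | add_left t ht s hs ih =>
    intro x' x hx hxa hxs
    obtain ⟨x₁, hx₁, hx₂⟩ := hx.exists_between
    obtain ⟨e, f, hex, het, hfx, hfs, hef⟩ := h6 x₁ x t s hx₂ hxs
    obtain ⟨e', f', he', hf', hx'⟩ := (hx₁.trans_le hef).exists_add
    obtain ⟨f₁, hf₁, hf₂⟩ := hf'.exists_between
    exact mono _ _ hx'.le (step e' e t f' f₁ he' (hex.trans hxa) ht het hf₁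
      (ih f₁ f hf₂ (hfx.trans hxa) hfs))

/-- One copy of `h` is split off by (O5), and the complement still contains an interpolant `h₁` of
the other copy; so `x ≤ h₁ + c ≤ 2 • c`, and nothing is lost up to ideals. -/
theorem exists_complement (h5 : O5 S) {h' h x : S} (hh : h' ≪ h) (hx : 2 • h ≤ x) :
    ∃ c, h' + c ≤ x ∧ x ≤ 2 • c := by
  obtain ⟨h₁, hh₁, hh₂⟩ := hh.exists_between
  obtain ⟨c, hc, hxc, hhc⟩ := h5 h' h₁ h₁ h x hh₁ hh₂
    ((add_le_add_left hh₂.le _).trans ((two_nsmul h).ge.trans hx))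
  refine ⟨c, hc, hxc.trans ?_⟩
  rw [two_nsmul]
  exact add_le_add_left hhc.le _

/-- Since `g ≤ z ≤ c + c` for the complement `c` of `h'`, (O6) splits `g` into two parts below `c`,
and (O7) joins them to one element that is still below `c`. -/
theorem exists_disjoint (h5 : O5 S) (h6 : O6 S) (h7 : O7 S) {h' h g' g z : S} (hh : h' ≪ h)
    (hz : 2 • h ≤ z) (hg : g' ≪ g) (hgz : g ≤ z) :
    ∃ w, h' + w ≤ z ∧ w ≤ 2 • g ∧ g' ≤ 2 • w := by
  obtain ⟨c, hc, hzc⟩ := exists_complement h5 hh hz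
  obtain ⟨g₁, hg₁, hg₂⟩ := hg.exists_between
  rw [two_nsmul] at hzc
  obtain ⟨e, f, heg, hec, hfg, hfc, hef⟩ := h6 g₁ g c c hg₂ (hgz.trans hzc)
  obtain ⟨e', f', he', hf', hg'⟩ := (hg₁.trans_le hef).exists_add
  obtain ⟨w, hew, hfw, hwc, hw⟩ := h7 e' e f' f c he' hec hf' hfc
  refine ⟨w, (add_le_add_right hwc _).trans hc, ?_, ?_⟩ <;> rw [two_nsmul]
  · exact hw.trans (add_le_add heg hfg)
  · exact hg'.le.trans (add_le_add hew.le hfw.le)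

end Basic

/-! ### Divisibility, scales, ideal-filteredness and property (V). -/

section Divisible

variable {S : Type*} [AddCommMonoid S] [PartialOrder S] [CuSemigroup S] {T : Set S}

theorem IsTwoOmegaDivisible.exists_le_infty {x' x : S} (hx : IsTwoOmegaDivisible x)
    (h : x' ≪ x) : ∃ y, 2 • y ≤ x ∧ x' ≤ infty y := by
  obtain ⟨y, n, hy, hn⟩ := hx x' h
  exact ⟨y, hy, hn.trans (nsmul_le_infty n y)⟩

theorem isTwoOmegaDivisible_of_le_infty {x : S}
    (h : ∀ x', x' ≪ x → ∃ y, 2 • y ≤ x ∧ x' ≤ infty y) : IsTwoOmegaDivisible x := by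
  intro x' hx'
  obtain ⟨x₁, hx₁, hx₂⟩ := hx'.exists_between
  obtain ⟨y, hy, hxy⟩ := h x₁ hx₂
  obtain ⟨n, hn⟩ := (hx₁.trans_le hxy).exists_le_nsmul
  exact ⟨y, n, hy, hn.le⟩

theorem le_two_nsmul (x : S) : x ≤ 2 • x := by
  rw [two_nsmul]
  exact le_add_right' x x

theorem le_of_two_nsmul_le {x y : S} (h : 2 • x ≤ y) : x ≤ y := (le_two_nsmul x).trans h

theorem exists_two_pow_nsmul_le (hT : IsLowerSet T) (hdiv : ∀ x ∈ T, IsTwoOmegaDivisible x)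
    (m : ℕ) : ∀ x' x, x ∈ T → x' ≪ x → ∃ h, 2 ^ m • h ≤ x ∧ x' ≤ infty h := by
  induction m with
  | zero => exact fun x' x _ hx => ⟨x, by simp, hx.le.trans (le_infty x)⟩
  | succ m ih =>
    intro x' x hxT hx
    obtain ⟨x₁, hx₁, hx₂⟩ := hx.exists_between
    obtain ⟨y, hy, hxy⟩ := (hdiv x hxT).exists_le_infty hx₂
    obtain ⟨y', hy', hxy'⟩ := (hx₁.trans_le hxy).exists_infty
    obtain ⟨h, hh, hyh⟩ := ih y' y (hT (le_of_two_nsmul_le hy) hxT) hy'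
    refine ⟨h, ?_, hxy'.le.trans (infty_le_infty_of_le hyh)⟩
    rw [pow_succ', mul_nsmul']
    exact (nsmul_le_nsmul_right hh 2).trans hy

/-- The elements `x` with this property for all `x' ≪ x` form an ideal containing `T`. -/
theorem IsScale.exists_le_mem_closure (hT : IsScale T) {x' x : S} (hx : x' ≪ x) :
    ∃ s ∈ AddSubmonoid.closure T, x' ≤ s := by
  have hI : IsIdeal {x : S | ∀ x', x' ≪ x → ∃ s ∈ AddSubmonoid.closure T, x' ≤ s} := by
    refine ⟨fun x' hx' => ⟨0, zero_mem _, hx'.le⟩, fun x hx y hy x' hx' => ?_,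
      fun x y hyx hx x' hx' => hx x' (hx'.trans_le hyx), fun z s hz hzI hs x' hx' => ?_⟩
    · obtain ⟨a, b, ha, hb, hab⟩ := hx'.exists_add
      obtain ⟨s, hs, has⟩ := hx a ha
      obtain ⟨t, ht, hbt⟩ := hy b hb
      exact ⟨s + t, add_mem hs ht, hab.le.trans (add_le_add has hbt)⟩
    · obtain ⟨n, hn⟩ := hx'.exists_wayBelow hz hs
      exact hzI n x' hn
  have hu := hT.generates _ hI fun x hx x' hx' => ⟨x, AddSubmonoid.subset_closure hx, hx'.le⟩
  exact Set.eq_univ_iff_forall.1 hu x x' hx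

theorem exists_disjoint_of_divisible (h5 : O5 S) (h6 : O6 S) (h7 : O7 S) {h' h g' g z : S}
    (hh : h' ≪ h) (hz : 2 • h ≤ z) (hdiv : IsTwoOmegaDivisible g) (hg : g' ≪ g) (hgz : g ≤ z) :
    ∃ w, h' + w ≤ z ∧ w ≤ g ∧ g' ≤ infty w := by
  obtain ⟨g₁, hg₁, hg₂⟩ := hg.exists_between
  obtain ⟨y, hy, hgy⟩ := hdiv.exists_le_infty hg₂
  obtain ⟨y', hy', hgy'⟩ := (hg₁.trans_le hgy).exists_infty
  -- Using the half `y` in place of `g` turns the bound `w ≤ 2 • y` into `w ≤ g`.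
  obtain ⟨w, hw, hwy, hyw⟩ :=
    exists_disjoint h5 h6 h7 hh hz hy' ((le_of_two_nsmul_le hy).trans hgz)
  exact ⟨w, hw, hwy.trans hy,
    hgy'.le.trans (infty_le_infty_of_le (hyw.trans (nsmul_le_infty 2 w)))⟩

theorem IsScale.twoOmegaDivisible (h5 : O5 S) (h6 : O6 S) (h7 : O7 S) (hT : IsScale T)
    (hdiv : ∀ x ∈ T, IsTwoOmegaDivisible x) : TwoOmegaDivisible S := by
  refine fun x => isTwoOmegaDivisible_of_le_infty fun x' hx' => ?_
  obtain ⟨x₁, hx₁, hx₂⟩ := hx'.exists_between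
  obtain ⟨s, hs, hxs⟩ := hT.exists_le_mem_closure hx₂
  -- All powers of two are carried along: adding a piece costs one factor of two, which pays for the
  -- complement.
  have key := wayBelow_sum_induction h6 (D := fun b => ∀ m : ℕ, ∃ h, 2 ^ m • h ≤ x ∧ b ≤ infty h)
    (a := x) (fun m => ⟨0, by simpa using zero_le x, zero_le _⟩)
    (fun b' b hb hD m => (hD m).imp fun h hh => ⟨hh.1, hb.trans hh.2⟩) ?_ hs x' x₁ hx₁ hx₂.le hxs 1
  · simpa using key
  intro e' e t b' b he hex ht het hb hD m
  obtain ⟨h, hhx, hbh⟩ := hD (m + 1)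
  obtain ⟨h', hh', hbh'⟩ := (hb.trans_le hbh).exists_infty
  rw [pow_succ', mul_nsmul'] at hhx
  have heT : e ∈ T := hT.isLowerSet het ht
  obtain ⟨e₁, he₁, he₂⟩ := he.exists_between
  have hpow : ∀ k : ℕ, k • h' ≪ k • h := by
    intro k
    induction k with
    | zero => simpa using zero_wayBelow _
    | succ k ih => simpa only [succ_nsmul] using ih.add hh'
  obtain ⟨w, hw, hwe, hew⟩ :=
    exists_disjoint_of_divisible h5 h6 h7 (hpow (2 ^ m)) hhx (hdiv e heT) he₂ hex
  obtain ⟨w', hw', hew'⟩ := (he₁.trans_le hew).exists_infty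
  obtain ⟨g, hgw, hwg⟩ :=
    exists_two_pow_nsmul_le hT.isLowerSet hdiv m w' w (hT.isLowerSet hwe heT) hw'
  refine ⟨h' + g, ?_, add_le_infty ?_ ?_⟩
  · rw [nsmul_add]
    exact (add_le_add_right hgw _).trans hw
  · exact hew'.le.trans (infty_le_infty_of_le (hwg.trans (infty_mono (le_add_left' _ _))))
  · exact hbh'.le.trans (infty_mono (le_add_right' _ _))

theorem exists_le_of_le_of_le (h5 : O5 S) (h6 : O6 S) (h7 : O7 S) (hT : IsLowerSet T)
    (hdiv : ∀ x ∈ T, IsTwoOmegaDivisible x) {f' f g' g x : S} (hx : x ∈ T) (hf : f' ≪ f)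
    (hg : g' ≪ g) (hfx : f ≤ x) (hgx : g ≤ x) :
    ∃ a b, a ≤ f ∧ b ≤ g ∧ a + b ≤ x ∧ f' ≤ infty a ∧ g' ≤ infty b := by
  obtain ⟨f₁, hf₁, hf₂⟩ := hf.exists_between
  obtain ⟨h, hh, hfh⟩ := (hdiv f (hT hfx hx)).exists_le_infty hf₂
  obtain ⟨h', hh', hfh'⟩ := (hf₁.trans_le hfh).exists_infty
  obtain ⟨w, hw, hwg, hgw⟩ :=
    exists_disjoint_of_divisible h5 h6 h7 hh' (hh.trans hfx) (hdiv g (hT hgx hx)) hg hgx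
  exact ⟨h', w, hh'.le.trans (le_of_two_nsmul_le hh), hwg, hw, hfh'.le, hgw⟩

/-- The element `b` lies in the ideal generated by a common lower bound of `x` and `y`. -/
def IsCommonlyDominated (x y b : S) : Prop := ∃ z, z ≤ x ∧ z ≤ y ∧ b ≤ infty z

theorem isCommonlyDominated_zero (x y : S) : IsCommonlyDominated x y 0 :=
  ⟨0, zero_le _, zero_le _, zero_le _⟩

theorem IsCommonlyDominated.mono {x y b' b : S} (hb : b' ≤ b) (h : IsCommonlyDominated x y b) :
    IsCommonlyDominated x y b' :=
  h.imp fun _ hz => ⟨hz.1, hz.2.1, hb.trans hz.2.2⟩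

/-- The two lower bounds are shrunk inside their ideals until their sum fits below `x`, then again
until it fits below `y`. -/
theorem IsCommonlyDominated.add (h5 : O5 S) (h6 : O6 S) (h7 : O7 S) (hT : IsLowerSet T)
    (hdiv : ∀ x ∈ T, IsTwoOmegaDivisible x) {x y a' a b' b : S} (hx : x ∈ T) (hy : y ∈ T)
    (ha : a' ≪ a) (hDa : IsCommonlyDominated x y a) (hb : b' ≪ b)
    (hDb : IsCommonlyDominated x y b) : IsCommonlyDominated x y (a' + b') := by
  obtain ⟨f, hfx, hfy, haf⟩ := hDa
  obtain ⟨g, hgx, hgy, hbg⟩ := hDb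
  obtain ⟨f', hf', haf'⟩ := (ha.trans_le haf).exists_infty
  obtain ⟨g', hg', hbg'⟩ := (hb.trans_le hbg).exists_infty
  obtain ⟨p, q, hpf, hqg, hpq, hfp, hgq⟩ :=
    exists_le_of_le_of_le h5 h6 h7 hT hdiv hx hf' hg' hfx hgx
  obtain ⟨p', hp', hap⟩ := (haf'.trans_le (infty_le_infty_of_le hfp)).exists_infty
  obtain ⟨q', hq', hbq⟩ := (hbg'.trans_le (infty_le_infty_of_le hgq)).exists_infty
  obtain ⟨r, s, hrp, hsq, hrs, hpr, hqs⟩ :=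
    exists_le_of_le_of_le h5 h6 h7 hT hdiv hy hp' hq' (hpf.trans hfy) (hqg.trans hgy)
  refine ⟨r + s, (add_le_add hrp hsq).trans hpq, hrs, add_le_infty ?_ ?_⟩
  · exact hap.le.trans (infty_le_infty_of_le (hpr.trans (infty_mono (le_add_right' _ _))))
  · exact hbq.le.trans (infty_le_infty_of_le (hqs.trans (infty_mono (le_add_left' _ _))))

theorem nsmul_mem_closure_singleton {M : Type*} [AddCommMonoid M] (n : ℕ) (t : M) :
    n • t ∈ AddSubmonoid.closure {t} :=
  nsmul_mem (AddSubmonoid.subset_closure (Set.mem_singleton t)) n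

theorem isCommonlyDominated_of_le (h5 : O5 S) (h6 : O6 S) (h7 : O7 S) (hT : IsLowerSet T)
    (hdiv : ∀ x ∈ T, IsTwoOmegaDivisible x) {x y e' e : S} {n : ℕ} (hx : x ∈ T) (hy : y ∈ T)
    (he : e' ≪ e) (hex : e ≤ x) (hey : e ≤ n • y) : IsCommonlyDominated x y e' := by
  refine wayBelow_sum_induction h6 (a := e) (isCommonlyDominated_zero x y) (fun b' b => .mono) ?_
    (nsmul_mem_closure_singleton n y) e' e he le_rfl hey
  intro d' d t b' b hd hde ht hdt hb hD
  exact .add h5 h6 h7 hT hdiv hx hy hd ⟨d, hde.trans hex, hdt.trans ht.le, le_infty d⟩ hb hD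

theorem isIdealFiltered_of_divisible (h5 : O5 S) (h6 : O6 S) (h7 : O7 S) (hT : IsLowerSet T)
    (hdiv : ∀ x ∈ T, IsTwoOmegaDivisible x) : IsIdealFiltered T := by
  intro v' v x hx y hy hv hvx hvy
  obtain ⟨x₀, hx₀, hvx₀⟩ := hvx.exists_infty
  obtain ⟨y₀, hy₀, hvy₀⟩ := hvy.exists_infty
  have hx₀T := hT hx₀.le hx
  have hy₀T := hT hy₀.le hy
  obtain ⟨v₁, hv₁, hv₂⟩ := hv.exists_between
  obtain ⟨m, hm⟩ := hvx₀.exists_le_nsmul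
  obtain ⟨n, hn⟩ := hvy₀.exists_le_nsmul
  obtain ⟨z, hzx, hzy, hvz⟩ : IsCommonlyDominated x₀ y₀ v₁ := by
    refine wayBelow_sum_induction h6 (a := v) (isCommonlyDominated_zero x₀ y₀)
      (fun b' b => .mono) ?_ (nsmul_mem_closure_singleton m x₀) v₁ v hv₂ le_rfl hm.le
    intro d' d t b' b hd hdv ht hdt hb hD
    obtain ⟨d₁, hd₁, hd₂⟩ := hd.exists_between
    -- Each piece already lies below `x₀`; being below `n • y₀`, it is cut a second time, along
    -- `y₀`.
    exact .add h5 h6 h7 hT hdiv hx₀T hy₀T hd₁ (isCommonlyDominated_of_le h5 h6 h7 hT hdiv hx₀T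
      hy₀T hd₂ (hdt.trans ht.le) (hdv.trans hn.le)) hb hD
  exact ⟨z, hv₁.trans_le hvz, hzx.trans_wayBelow hx₀, hzy.trans_wayBelow hy₀⟩

theorem hasPropertyV_of_divisible (hdiv : ∀ x ∈ T, IsTwoOmegaDivisible x) : HasPropertyV T := by
  intro d₁' _ d₁ _ d₂' _ d₂ _ c _ x hx h₁ h₂ _ _ hcx₁ hcx₂
  obtain ⟨x', hx₁, hx₂, hx'⟩ := WayBelow.exists_upper
    (h₁.le.trans_wayBelow ((le_add_left' d₁ c).trans_wayBelow hcx₁))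
    (h₂.le.trans_wayBelow ((le_add_left' d₂ c).trans_wayBelow hcx₂))
  obtain ⟨y, hy, hxy⟩ := (hdiv x hx).exists_le_infty hx'
  have h := add_le_infty (hx₁.le.trans hxy) (hx₂.le.trans hxy)
  exact ⟨y, y, (two_nsmul y).ge.trans hy, h, h⟩

/-- The complements of `u₁` and `f₁` are both full in `x`, so filteredness gives `p` below both,
large enough to meet `u₁` and `f₁` in `d` and `e`. Then `p + d` and `p + e` fit into `x`, and
property (V) applies with `p` as the common element. A common part of the resulting `y` and `z` fits
twice. -/
theorem exists_two_nsmul_le_of_propertyV (h5 : O5 S) (hT : IsLowerSet T)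
    (hfil : IsIdealFiltered T) (hV : HasPropertyV T) {x u₀ u f₀ f : S} (hx : x ∈ T)
    (hu : u₀ ≪ u) (hf : f₀ ≪ f) (hux : 2 • u ≤ x) (hfx : 2 • f ≤ x) :
    ∃ t, 2 • t ≤ x ∧ u₀ ≤ infty t ∧ f₀ ≤ infty t := by
  obtain ⟨u₁, hu₁, hu₂⟩ := hu.exists_between
  obtain ⟨f₁, hf₁, hf₂⟩ := hf.exists_between
  obtain ⟨c, hc, hxc⟩ := exists_complement h5 hu₂ hux
  obtain ⟨r, hr, hxr⟩ := exists_complement h5 hf₂ hfx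
  have hcT : c ∈ T := hT ((le_add_left' _ _).trans hc) hx
  have hrT : r ∈ T := hT ((le_add_left' _ _).trans hr) hx
  have hu₁T : u₁ ∈ T := hT ((le_add_right' _ _).trans hc) hx
  have hf₁T : f₁ ∈ T := hT ((le_add_right' _ _).trans hr) hx
  obtain ⟨x₁, hux₁, hfx₁, hx₁⟩ := WayBelow.exists_upper
    (hu₂.trans_le (le_of_two_nsmul_le hux)) (hf₂.trans_le (le_of_two_nsmul_le hfx))
  obtain ⟨x₂, hx₁₂, hx₂⟩ := hx₁.exists_between
  obtain ⟨p, hxp, hpc, hpr⟩ := hfil x₁ x₂ c hcT r hrT hx₁₂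
    (hx₂.trans_le (hxc.trans (nsmul_le_infty 2 c)))
    (hx₂.trans_le (hxr.trans (nsmul_le_infty 2 r)))
  have hpT : p ∈ T := hT hpc.le hcT
  have meet : ∀ a₀ a, a ∈ T → a₀ ≪ a → a ≤ x₁ →
      ∃ d' d, d' ≪ d ∧ d ≪ a ∧ d ≪ p ∧ a₀ ≪ infty d' := by
    intro a₀ a ha h₀ hax
    obtain ⟨a₁, h₀₁, h₁⟩ := h₀.exists_between
    obtain ⟨a₂, h₁₂, h₂⟩ := h₁.exists_between
    obtain ⟨d, hd, hda, hdp⟩ := hfil a₁ a₂ a ha p hpT h₁₂ (h₂.trans_le (le_infty a))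
      (h₂.trans_le (hax.trans hxp.le))
    obtain ⟨d', hd', had'⟩ := (h₀₁.trans_le hd.le).exists_infty
    exact ⟨d', d, hd', hda, hdp, had'⟩
  obtain ⟨u₂, hu₀₂, hu₂₁⟩ := hu₁.exists_between
  obtain ⟨f₂, hf₀₂, hf₂₁⟩ := hf₁.exists_between
  obtain ⟨d', d, hd', hdu, hdp, hud⟩ := meet u₂ u₁ hu₁T hu₂₁ hux₁.le
  obtain ⟨e', e, he', hef, hep, hfe⟩ := meet f₂ f₁ hf₁T hf₂₁ hfx₁.le
  have hdT : d ∈ T := hT hdp.le hpT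
  have heT : e ∈ T := hT hep.le hpT
  obtain ⟨y, z, hyz, hy, hz⟩ := hV d' (hT hd'.le hdT) d hdT e' (hT he'.le heT) e heT p hpT x hx
    hd' he' hdp hep ((hpc.add hdu).trans_le ((add_comm c u₁).le.trans hc))
    ((hpr.add hef).trans_le ((add_comm r f₁).le.trans hr))
  have dominated : ∀ w, d' + e' ≤ infty w → u₂ + f₂ ≪ infty w := by
    intro w hw
    refine (hud.add hfe).trans_le (add_le_infty ?_ ?_)
    · exact infty_le_infty_of_le ((le_add_right' _ _).trans hw)
    · exact infty_le_infty_of_le ((le_add_left' _ _).trans hw)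
  obtain ⟨t, hut, hty, htz⟩ := hfil (u₀ + f₀) (u₂ + f₂) y (hT ((le_add_right' _ _).trans hyz) hx)
    z (hT ((le_add_left' _ _).trans hyz) hx) (hu₀₂.add hf₀₂) (dominated y hy) (dominated z hz)
  refine ⟨t, ?_, (le_add_right' _ _).trans hut.le, (le_add_left' _ _).trans hut.le⟩
  rw [two_nsmul]
  exact (add_le_add hty.le htz.le).trans hyz

theorem isTwoOmegaDivisible_of_propertyV (h5 : O5 S) (h6 : O6 S) (hT : IsLowerSet T)
    (hweak : ∀ x ∈ T, IsWeaklyTwoOmegaDivisible x) (hfil : IsIdealFiltered T)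
    (hV : HasPropertyV T) {x : S} (hx : x ∈ T) : IsTwoOmegaDivisible x := by
  refine isTwoOmegaDivisible_of_le_infty fun x' hx' => ?_
  obtain ⟨x₁, hx₁, hx₂⟩ := hx'.exists_between
  obtain ⟨n, y, hy, hxy⟩ := hweak x hx x₁ hx₂
  have hmem : ∑ j, y j ∈ AddSubmonoid.closure {t : S | 2 • t ≤ x} :=
    sum_mem fun j _ => AddSubmonoid.subset_closure (hy j)
  refine wayBelow_sum_induction h6 (D := fun b => ∃ t, 2 • t ≤ x ∧ b ≤ infty t) (a := x)
    ⟨0, by simpa using zero_le x, zero_le _⟩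
    (fun b' b hb hD => hD.imp fun t ht => ⟨ht.1, hb.trans ht.2⟩) ?_ hmem x' x₁ hx₁ hx₂.le hxy
  rintro e' e t b' b he - ht het hb ⟨s, hs, hbs⟩
  obtain ⟨s', hs', hbs'⟩ := (hb.trans_le hbs).exists_infty
  obtain ⟨r, hr, her, hsr⟩ := exists_two_nsmul_le_of_propertyV h5 hT hfil hV hx he hs'
    ((nsmul_le_nsmul_right het 2).trans ht) hs
  exact ⟨r, hr, add_le_infty her (hbs'.le.trans (infty_le_infty_of_le hsr))⟩

end Divisible

/-! ### Strongly soft elements. -/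

section Soft

variable {S : Type*} [AddCommMonoid S] [PartialOrder S] [CuSemigroup S] {T : Set S}

theorem isTwoOmegaDivisible_of_abundance (hT : IsLowerSet T) (hfil : IsIdealFiltered T)
    (hsoft : HasAbundanceOfStronglySoft T) {x : S} (hx : x ∈ T) : IsTwoOmegaDivisible x := by
  refine isTwoOmegaDivisible_of_le_infty fun x' hx' => ?_
  obtain ⟨x₁, hx₁, hx₁'⟩ := hx'.exists_between
  obtain ⟨x₂, hx₂, hx₂'⟩ := hx₁'.exists_between
  obtain ⟨y, hy, hxy, hyx⟩ := hsoft x₂ (hT hx₂'.le hx) x hx hx₂'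
  obtain ⟨y', hy', hxy'⟩ := (hx₂.trans_le hxy).exists_infty
  obtain ⟨t, ht, hyt⟩ := hy y' hy'
  have htx : y' + t ≤ x := ht.le.trans hyx
  obtain ⟨z, hz, hzy, hzt⟩ := hfil x' x₁ y' (hT (hy'.le.trans hyx) hx) t
    (hT ((le_add_left' _ _).trans htx) hx) hx₁ hxy'
    (hxy'.trans_le (infty_le_infty_of_le hyt.le))
  refine ⟨z, ?_, hz.le⟩
  rw [two_nsmul]
  exact (add_le_add hzy.le hzt.le).trans htx

theorem isStronglySoft_of_seq {y z : ℕ → S} {s : S} (hadd : ∀ n, y (n + 1) = y n + z n)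
    (hle : ∀ n, y n ≤ infty (z n)) (hs : IsLUB (Set.range y) s) : IsStronglySoft s := by
  intro x' hx'
  obtain ⟨n, hn⟩ := hx'.exists_wayBelow
    (monotone_nat_of_le_succ fun n => (le_add_right' _ _).trans (hadd n).ge) hs
  obtain ⟨t, ht, hxt⟩ := (hn.trans_le (hle n)).exists_infty
  exact ⟨t, (hn.add ht).trans_le ((hadd n).ge.trans (hs.1 ⟨n + 1, rfl⟩)), hxt⟩

/-- Here `c` is the room left in `x` beside `2 • y`. A quarter of `c` is needed: two copies provide
the doubled new term, and the other two make the new room `c'` generate the same ideal as `c`. -/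
theorem exists_extension_of_divisible (h5 : O5 S) (hdiv : TwoOmegaDivisible S) {x y c x' : S}
    (hy : y ≪ infty x) (hyc : 2 • y + c ≤ x) (hxc : x ≤ infty c) (hx' : x' ≪ x) :
    ∃ z c', y + z ≪ infty x ∧ 2 • (y + z) + c' ≤ x ∧ x ≤ infty c' ∧ y ≤ infty z ∧
      x' ≤ infty z := by
  obtain ⟨w, hyw, hxw, hw⟩ := hy.exists_upper (hx'.trans_le (le_infty x))
  obtain ⟨c₀, hc₀, hwc⟩ := (hw.trans_le (infty_le_infty_of_le hxc)).exists_infty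
  obtain ⟨h, hh, hch⟩ := exists_two_pow_nsmul_le isLowerSet_univ (fun x _ => hdiv x) 2 c₀ c
    (Set.mem_univ c) hc₀
  have hwh := hwc.trans_le (infty_le_infty_of_le hch)
  obtain ⟨w', hyw', hxw', hw'⟩ := hyw.exists_upper hxw
  obtain ⟨z, hz, hwz⟩ := (hw'.trans_le hwh.le).exists_infty
  rw [pow_two, mul_nsmul'] at hh
  obtain ⟨c', hzc, hcc⟩ := exists_complement h5 hz.two_nsmul hh
  refine ⟨z, c', ?_, ?_, ?_, hyw'.le.trans hwz.le, hxw'.le.trans hwz.le⟩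
  · refine (hy.add (hz.trans_le (?_ : h ≤ infty x))).trans_le (infty_add_infty x).le
    exact (le_of_two_nsmul_le (le_of_two_nsmul_le hh)).trans
      (((le_add_left' _ _).trans hyc).trans (le_infty x))
  · rw [nsmul_add, add_assoc]
    exact (add_le_add_right hzc _).trans hyc
  · exact hxc.trans (infty_le_infty_of_le (hcc.trans (nsmul_le_infty 2 c')))

theorem exists_isStronglySoft (h5 : O5 S) (hdiv : TwoOmegaDivisible S) (x : S) :
    ∃ y : S, IsStronglySoft y ∧ 2 • y ≤ x ∧ x ≤ infty y := by
  obtain ⟨a, ha, hax, hal⟩ := exists_seq x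
  -- A state consists of a partial sum and the room left beside its double. The `n`-th term also
  -- dominates `a n`, so the limit generates an ideal containing `x`.
  let P := {p : S × S // p.1 ≪ infty x ∧ 2 • p.1 + p.2 ≤ x ∧ x ≤ infty p.2}
  have step : ∀ (n : ℕ) (p : P), ∃ (q : P) (z : S), q.1.1 = p.1.1 + z ∧ p.1.1 ≤ infty z ∧
      a n ≤ infty z := by
    rintro n ⟨⟨y, c⟩, hy, hyc, hxc⟩
    obtain ⟨z, c', h₁, h₂, h₃, h₄, h₅⟩ :=
      exists_extension_of_divisible h5 hdiv hy hyc hxc (hax n)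
    exact ⟨⟨(y + z, c'), h₁, h₂, h₃⟩, z, rfl, h₄, h₅⟩
  choose q z hq hpz haz using step
  let p : ℕ → P := fun n => Nat.rec
    ⟨(0, x), zero_wayBelow _, by simp, le_infty x⟩ (fun n p => q n p) n
  have hadd : ∀ n, (p (n + 1)).1.1 = (p n).1.1 + z n (p n) := fun n => hq n (p n)
  have hmono : Monotone fun n => (p n).1.1 :=
    monotone_nat_of_le_succ fun n => (le_add_right' _ _).trans (hadd n).ge
  obtain ⟨y, hy⟩ := CuSemigroup.exists_isLUB _ hmono
  refine ⟨y, isStronglySoft_of_seq hadd (fun n => hpz n (p n)) hy, ?_, hal.2 ?_⟩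
  · refine (isLUB_nsmul hmono hy 2).2 ?_
    rintro _ ⟨n, rfl⟩
    exact (le_add_right' _ _).trans (p n).2.2.1
  · rintro _ ⟨n, rfl⟩
    refine (haz n (p n)).trans (infty_mono (le_trans ?_ (hy.1 ⟨n + 1, rfl⟩)))
    exact (le_add_left' _ _).trans (hadd n).ge

end Soft

end Cu

theorem mainTheorem8 {S : Type*} [AddCommMonoid S] [PartialOrder S] [Cu.CuSemigroup S]
    (h5 : Cu.O5 S) (h6 : Cu.O6 S) (h7 : Cu.O7 S) (h8 : Cu.O8 S)
    (T : Set S) (hT : Cu.IsScale T) :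
    List.TFAE
      [ Cu.TwoOmegaDivisible S,
        ∀ x ∈ T, Cu.IsTwoOmegaDivisible x,
        (∀ x ∈ T, Cu.IsWeaklyTwoOmegaDivisible x) ∧ Cu.IsIdealFiltered T ∧ Cu.HasPropertyV T,
        Cu.IsIdealFiltered T ∧
          ∀ x : S, ∃ y : S, Cu.IsStronglySoft y ∧ 2 • y ≤ x ∧ x ≤ Cu.infty y,
        Cu.IsIdealFiltered T ∧ Cu.HasAbundanceOfStronglySoft T ] := by
  tfae_have 1 → 2 := fun h x _ => h x
  tfae_have 2 → 1 := hT.twoOmegaDivisible h5 h6 h7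
  tfae_have 2 → 3 := fun h =>
    ⟨fun x hx => (h x hx).isWeaklyTwoOmegaDivisible,
      Cu.isIdealFiltered_of_divisible h5 h6 h7 hT.isLowerSet h, Cu.hasPropertyV_of_divisible h⟩
  tfae_have 3 → 2 := fun h x hx =>
    Cu.isTwoOmegaDivisible_of_propertyV h5 h6 hT.isLowerSet h.1 h.2.1 h.2.2 hx
  tfae_have 1 → 4 := fun h =>
    ⟨Cu.isIdealFiltered_of_divisible h5 h6 h7 hT.isLowerSet fun x _ => h x,
      Cu.exists_isStronglySoft h5 h⟩
  tfae_have 4 → 5 := fun h => ⟨h.1, fun x' _ x _ hx =>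
    (h.2 x).imp fun y hy => ⟨hy.1, hx.le.trans hy.2.2, Cu.le_of_two_nsmul_le hy.2.1⟩⟩
  tfae_have 5 → 2 := fun h x hx =>
    Cu.isTwoOmegaDivisible_of_abundance hT.isLowerSet h.1 h.2 hx
  tfae_finish
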